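/- Let $d\ge 1$, $\sigma_0,\sigma_T>0$ and $\mathsf a_0,\mathsf a_T\in\mathbb R^d$, and put $\varphi_0(\mathsf x)=\exp\left[-\frac{|\mathsf x-\mathsf a_0|^2}{2\sigma_0}\right]$, $\psi_T(\mathsf x)=\exp\left[-\frac{|\mathsf x-\mathsf a_T|^2}{2\sigma_T}\right]$ and $\rho_{0}=\frac{\sigma_{0}}{1+\sigma_{0}}$, $\rho_{T}=\frac{\sigma_{T}}{1+\sigma_{T}}$. (The indices $0,T$ of $\sigma,\mathsf a,\rho$ are labels: these parameters do not depend on the time horizon $T$.) Let $$g(\mathsf x,t,\mathsf y)=(2\pi\sinh t)^{-d/2}\exp\left[-\frac{\cosh(t)(|\mathsf x|^2+|\mathsf y|^2)-2(\mathsf x,\mathsf y)}{2\sinh t}\right]$$ be Mehler's kernel, that is, Green's function of $\partial_t u=\frac12\Delta u-\frac{|\mathsf x|^2}{2}u$. For $T>0$ let $\mathcal N>0$ be given by $\mathcal N^2\int\int\varphi_0(\mathsf x)g(\mathsf x,T,\mathsf y)\psi_T(\mathsf y)\,d\mathsf x\,d\mathsf y=1$, put $\varphi=\mathcal N\varphi_0$,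 $\psi=\mathcal N\psi_T$, and let $\mu$ be the probability measure on $\mathbb R^d\times\mathbb R^d$ with density $\varphi(\mathsf x)g(\mathsf x,T,\mathsf y)\psi(\mathsf y)$. Let $(Z_\tau)_{\tau\in[0,T]}$ be the Bernstein process on a probability space $(\Omega,\mathcal F,\mathbb P_\mu)$ associated with the forward-backward system $$\partial_t u=\tfrac12\Delta u-\tfrac{|\mathsf x|^2}{2}u,\quad u(\cdot,0)=\varphi;\qquad -\partial_t v=\tfrac12\Delta v-\tfrac{|\mathsf x|^2}{2}v,\quad v(\cdot,T)=\psi.$$ This means that, for all $0\le s<r<t\le T$, * $\mathbb E(f(Z_r)\mid Z_\tau,\ \tau\in[0,s]\cup[t,T])=\mathbb E(f(Z_r)\mid Z_s,Z_t)$ for every bounded Borel function $f:\mathbb R^d\to\mathbb R$; * $\mathbb P_\mu(Z_r\in F\mid Z_s,Z_t)=\int_F g(Z_t,t-s,Z_s)^{-1}g(Z_t,t-r,\mathsf z)\,g(\mathsf z,r-s,Z_s)\,d\mathsf z$ for every Borel set $F$; and that $(Z_0,Z_T)$ has joint law $\mu$. Then there are constants $C$ and $T_1$, depending only on $d,\sigma_0,\sigma_T,\mathsf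 a_0,\mathsf a_T$, such that for all $T>0$ with $T\ge T_1$ and every such process the following statements hold. (a) For all Borel sets $F_0,F_T\subset\mathbb R^d$, $$\left|\mathbb P_\mu(Z_0\in F_0,Z_T\in F_T)-(4\pi^2\rho_0\rho_T)^{-\frac d2}\int_{F_0}\exp\left[-\frac{1}{2\rho_0}\left|\mathsf x-\frac{\mathsf a_0}{1+\sigma_0}\right|^2\right]d\mathsf x\int_{F_T}\exp\left[-\frac{1}{2\rho_T}\left|\mathsf x-\frac{\mathsf a_T}{1+\sigma_T}\right|^2\right]d\mathsf x\right|\le Ce^{-T}.$$ In particular, $$\left|\mathbb P_\mu(Z_0\in F_0)-(2\pi\rho_0)^{-\frac d2}\int_{F_0}\exp\left[-\frac{1}{2\rho_0}\left|\mathsf x-\frac{\mathsf a_0}{1+\sigma_0}\right|^2\right]d\mathsf x\right|\le Ce^{-T},$$ $$\left|\mathbb P_\mu(Z_T\in F_T)-(2\pi\rho_T)^{-\frac d2}\int_{F_T}\exp\left[-\frac{1}{2\rho_T}\left|\mathsf x-\frac{\mathsf a_T}{1+\sigma_T}\right|^2\right]d\mathsf x\right|\le Ce^{-T}.$$ (b)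 If $\sigma_0=\sigma_T=:\sigma$, $\mathsf a_0=\mathsf a_T=:\mathsf a$, and the process $(Z_\tau)_{\tau\in[0,T]}$ is stationary (its finite-dimensional distributions are invariant under time shifts that stay inside $[0,T]$), then, with $\rho=\frac{\sigma}{1+\sigma}$, for every $t\in[0,T]$ and every Borel set $F\subset\mathbb R^d$, $$\left|\mathbb P_\mu(Z_t\in F)-(2\pi\rho)^{-\frac d2}\int_F\exp\left[-\frac{1}{2\rho}\left|\mathsf x-\frac{\mathsf a}{1+\sigma}\right|^2\right]d\mathsf x\right|\le Ce^{-T}.$$ -/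

import Mathlib

open MeasureTheory Filter Topology Set
open scoped InnerProductSpace

namespace Bernstein

/-- The state space `ℝ^d` with its Euclidean norm, Borel sigma-algebra and Lebesgue measure. -/
abbrev E (d : ℕ) : Type := EuclideanSpace ℝ (Fin d)

/-- The harmonic potential `V(x) = |x|² / 2`. -/
noncomputable def harmonicPotential {d : ℕ} (x : E d) : ℝ := ‖x‖ ^ 2 / 2

/-- The properties of Green's function (heat kernel) of `∂ₜ u = ½ Δ u - V u`: positivity, symmetry,
the equation in `(x, t)`, and the Dirac initial condition. -/
structure IsGreenFunction {d : ℕ} (V : E d → ℝ) (g : E d → ℝ → E d → ℝ) : Prop where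
  pos : ∀ x y t, 0 < t → 0 < g x t y
  symm : ∀ x y t, 0 < t → g x t y = g y t x
  equation : ∀ x y t, 0 < t →
    HasDerivAt (fun t => g x t y) (2⁻¹ * Laplacian.laplacian (fun x => g x t y) x - V x * g x t y) t
  initial : ∀ f : E d → ℝ, Continuous f → (∃ C, ∀ y, |f y| ≤ C) → ∀ x,
    Tendsto (fun t => ∫ y, g x t y * f y) (𝓝[>] 0) (𝓝 (f x))

/-- Mehler's `d`-dimensional kernel: Green's function of the forward-backward system with the
harmonic potential. -/
noncomputable def mehlerKernel {d : ℕ} (x : E d) (t : ℝ) (y : E d) : ℝ :=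
  (2 * Real.pi * Real.sinh t) ^ (-(d : ℝ) / 2) *
    Real.exp (-(Real.cosh t * (‖x‖ ^ 2 + ‖y‖ ^ 2) - 2 * ⟪x, y⟫_ℝ) / (2 * Real.sinh t))

/-- The (unnormalized) Gaussian function `exp(-|x - a|² / (2σ))`. -/
noncomputable def gaussianFun {d : ℕ} (σ : ℝ) (a : E d) (x : E d) : ℝ :=
  Real.exp (-(‖x - a‖ ^ 2 / (2 * σ)))

section Construction

variable {d : ℕ}

/-- The normalization factor `𝒩 > 0`, determined by
`𝒩² ∫∫ φ₀(x) g(x,T,y) ψ_T(y) dx dy = 1`. -/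
noncomputable def normFactor (g : E d → ℝ → E d → ℝ) (φ₀ ψT : E d → ℝ) (T : ℝ) : ℝ :=
  (√(∫ p : E d × E d, φ₀ p.1 * g p.1 T p.2 * ψT p.2))⁻¹

/-- The measure `μ` on `ℝ^d × ℝ^d` with density `φ(x) g(x,T,y) ψ(y)`, where `φ = 𝒩 φ₀` and
`ψ = 𝒩 ψ_T` are the initial and final data. -/
noncomputable def endpointMeasure (g : E d → ℝ → E d → ℝ) (φ₀ ψT : E d → ℝ) (T : ℝ) :
    Measure (E d × E d) :=
  (volume : Measure (E d × E d)).withDensity fun p => ENNReal.ofReal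
    ((normFactor g φ₀ ψT T * φ₀ p.1) * g p.1 T p.2 * (normFactor g φ₀ ψT T * ψT p.2))

/-- `p(x,t; z,r; y,s) = g(x,t-s,y)⁻¹ g(x,t-r,z) g(z,r-s,y)`. -/
noncomputable def bernsteinDensity (g : E d → ℝ → E d → ℝ)
    (x : E d) (t : ℝ) (z : E d) (r : ℝ) (y : E d) (s : ℝ) : ℝ :=
  (g x (t - s) y)⁻¹ * g x (t - r) z * g z (r - s) y

/-- `P(x,t; F,r; y,s) = ∫_F p(x,t; z,r; y,s) dz`. -/
noncomputable def transitionFun (g : E d → ℝ → E d → ℝ)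
    (x : E d) (t : ℝ) (F : Set (E d)) (r : ℝ) (y : E d) (s : ℝ) : ℝ :=
  ∫ z in F, bernsteinDensity g x t z r y s

variable {Ω : Type*}

/-- `𝓕_s⁺`, generated by the process on `[0, s]`. -/
abbrev pastSigma (Z : ℝ → Ω → E d) (s : ℝ) : MeasurableSpace Ω :=
  ⨆ τ ∈ Icc (0 : ℝ) s, MeasurableSpace.comap (Z τ) inferInstance

/-- `𝓕_t⁻`, generated by the process on `[t, T]`. -/
abbrev futureSigma (T : ℝ) (Z : ℝ → Ω → E d) (t : ℝ) : MeasurableSpace Ω :=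
  ⨆ τ ∈ Icc t T, MeasurableSpace.comap (Z τ) inferInstance

/-- The sigma-algebra generated by `(Z_s, Z_t)`. -/
abbrev pairSigma (Z : ℝ → Ω → E d) (s t : ℝ) : MeasurableSpace Ω :=
  MeasurableSpace.comap (fun ω => (Z s ω, Z t ω)) inferInstance

variable [MeasurableSpace Ω]

/-- `Z_τ`, `τ ∈ [0, T]`, is a Bernstein process under `Pr`. Only the restriction of
`Z` to the times in `[0, T]` matters. -/
structure IsBernsteinProcess (T : ℝ) (Pr : Measure Ω) (Z : ℝ → Ω → E d) : Prop where
  measurable : ∀ τ ∈ Icc 0 T, Measurable (Z τ)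
  bernstein : ∀ f : E d → ℝ, Measurable f → (∃ C, ∀ x, |f x| ≤ C) →
    ∀ r s t : ℝ, 0 ≤ s → s < r → r < t → t ≤ T →
      Pr[fun ω => f (Z r ω) | pastSigma Z s ⊔ futureSigma T Z t]
        =ᵐ[Pr] Pr[fun ω => f (Z r ω) | pairSigma Z s t]

/-- `Z` is the Bernstein process on `[0, T]` associated with the forward-backward system that has
Green's function `g` and the data `𝒩 φ₀`, `𝒩 ψ_T`: a Bernstein process with transition
function `P` for which `(Z_0, Z_T)` has law `μ`. -/
structure IsAssociatedBernsteinProcess (g : E d → ℝ → E d → ℝ) (φ₀ ψT : E d → ℝ) (T : ℝ)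
    (Pr : Measure Ω) (Z : ℝ → Ω → E d) : Prop extends IsBernsteinProcess T Pr Z where
  transition : ∀ F : Set (E d), MeasurableSet F →
    ∀ r s t : ℝ, 0 ≤ s → s < r → r < t → t ≤ T →
      Pr[(Z r ⁻¹' F).indicator (fun _ => (1 : ℝ)) | pairSigma Z s t]
        =ᵐ[Pr] fun ω => transitionFun g (Z t ω) t F r (Z s ω) s
  joint : ∀ F₀ FT : Set (E d), MeasurableSet F₀ → MeasurableSet FT →
    Pr (Z 0 ⁻¹' F₀ ∩ Z T ⁻¹' FT) = endpointMeasure g φ₀ ψT T (F₀ ×ˢ FT)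

/-- `Z_τ`, `τ ∈ [0, T]`, is (strictly) stationary under `Pr`: its finite-dimensional distributions
are invariant under every time shift that stays inside `[0, T]`. -/
def IsStationaryOn (T : ℝ) (Pr : Measure Ω) (Z : ℝ → Ω → E d) : Prop :=
  ∀ (n : ℕ) (τ : Fin n → ℝ) (h : ℝ), (∀ i, τ i ∈ Icc 0 T) → (∀ i, τ i + h ∈ Icc 0 T) →
    Pr.map (fun ω i => Z (τ i + h) ω) = Pr.map (fun ω i => Z (τ i) ω)

end Construction

/-- `ρ = σ / (1 + σ)`. -/
noncomputable def rho (σ : ℝ) : ℝ := σ / (1 + σ)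

/-- `∫_F exp(-|x - a/(1+σ)|² / (2ρ)) dx` with `ρ = σ / (1 + σ)`. -/
noncomputable def gaussianIntegral {d : ℕ} (σ : ℝ) (a : E d) (F : Set (E d)) : ℝ :=
  ∫ x in F, Real.exp (-(1 / (2 * rho σ)) * ‖x - (1 + σ)⁻¹ • a‖ ^ 2)


theorem mehlerKernel_equation {d : ℕ} (x y : E d) (t : ℝ) (ht : 0 < t) :
    HasDerivAt (fun t => mehlerKernel x t y)
      (2⁻¹ * Laplacian.laplacian (fun x => mehlerKernel x t y) x -
        harmonicPotential x * mehlerKernel x t y) t := by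
  have hs : 0 < Real.sinh t := Real.sinh_pos_iff.2 ht
  set c := Real.cosh t with hc
  set s := Real.sinh t with hs'
  have hcs : c ^ 2 = s ^ 2 + 1 := Real.cosh_sq t
  set k : ℝ := (2 * Real.pi * s) ^ (-(d : ℝ) / 2) with hk
  -- second derivatives in the space variable
  have h1 : ∀ z : E d, HasFDerivAt (fun x => mehlerKernel x t y)
      (mehlerKernel z t y • ((s⁻¹ • innerSL ℝ y - (c / s) • innerSL ℝ z : E d →L[ℝ] ℝ))) z := by
    intro z
    have e1 : HasFDerivAt (fun x : E d => ‖x‖ ^ 2) (2 • innerSL ℝ z) z :=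
      (hasStrictFDerivAt_norm_sq z).hasFDerivAt
    have e2 : HasFDerivAt (fun x : E d => ⟪x, y⟫_ℝ) (innerSL ℝ y) z := by
      have := (innerSL ℝ y).hasFDerivAt (x := z)
      refine this.congr_of_eventuallyEq (Eventually.of_forall fun w => ?_)
      simp [real_inner_comm]
    have e3 := ((((e1.add_const (‖y‖ ^ 2)).const_mul c).sub (e2.const_mul 2)).neg.mul_const
      (2 * s)⁻¹).exp.const_mul k
    refine (e3.congr_of_eventuallyEq (Eventually.of_forall fun w => ?_)).congr_fderiv ?_
    · simp [mehlerKernel, div_eq_mul_inv, k, c, s]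
    · ext w
      simp [mehlerKernel, div_eq_mul_inv, k, c, s]
      field_simp
  have hL : Laplacian.laplacian (fun x => mehlerKernel x t y) x =
      mehlerKernel x t y * (‖s⁻¹ • y - (c / s) • x‖ ^ 2 - d * (c / s)) := by
    have hf : fderiv ℝ (fun x => mehlerKernel x t y) = fun z => mehlerKernel z t y •
        ((s⁻¹ • innerSL ℝ y - (c / s) • innerSL ℝ z : E d →L[ℝ] ℝ)) :=
      funext fun z => (h1 z).fderiv
    have h2 : HasFDerivAt (fun z : E d => (s⁻¹ • innerSL ℝ y - (c / s) • innerSL ℝ z : E d →L[ℝ] ℝ))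
        (-((c / s) • (innerSL ℝ : E d →L[ℝ] E d →L[ℝ] ℝ))) x :=
      ((innerSL ℝ : E d →L[ℝ] E d →L[ℝ] ℝ).hasFDerivAt.const_smul (c / s)).const_sub _
    have h3 := (h1 x).smul h2
    rw [InnerProductSpace.laplacian_eq_iteratedFDeriv_orthonormalBasis _
      (EuclideanSpace.basisFun (Fin d) ℝ)]
    have h4 := h3.fderiv
    rw [show (fun x => mehlerKernel x t y) • (fun z : E d => (s⁻¹ • innerSL ℝ y - (c / s) •
      innerSL ℝ z : E d →L[ℝ] ℝ)) = fderiv ℝ (fun x => mehlerKernel x t y) from hf.symm] at h4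
    have h5 : ∀ i : Fin d, iteratedFDeriv ℝ 2 (fun x => mehlerKernel x t y) x
        ![EuclideanSpace.basisFun (Fin d) ℝ i, EuclideanSpace.basisFun (Fin d) ℝ i] =
        mehlerKernel x t y * ((s⁻¹ * y i - (c / s) * x i) ^ 2 - c / s) := by
      intro i
      rw [iteratedFDeriv_two_apply, h4]
      have h6 : innerSL ℝ (EuclideanSpace.single i (1 : ℝ)) (EuclideanSpace.single i (1 : ℝ)) =
          (1 : ℝ) := by
        change ⟪EuclideanSpace.single i (1 : ℝ), EuclideanSpace.single i (1 : ℝ)⟫_ℝ = 1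
        simp
      simp [EuclideanSpace.inner_single_right, h6]
      ring
    simp only [h5, ← Finset.mul_sum, Finset.sum_sub_distrib, EuclideanSpace.norm_sq_eq]
    simp
  rw [hL]
  have g1 : HasDerivAt (fun t : ℝ => (2 * Real.pi * Real.sinh t) ^ (-(d : ℝ) / 2))
      (2 * Real.pi * c * (-(d : ℝ) / 2) * (2 * Real.pi * s) ^ (-(d : ℝ) / 2 - 1)) t :=
    ((Real.hasDerivAt_sinh t).const_mul (2 * Real.pi)).rpow_const (Or.inl (by positivity))
  have g2 := ((((Real.hasDerivAt_cosh t).mul_const (‖x‖ ^ 2 + ‖y‖ ^ 2)).sub_const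
    (2 * ⟪x, y⟫_ℝ)).neg.div ((Real.hasDerivAt_sinh t).const_mul 2) (by positivity)).exp
  refine (g1.mul g2).congr_deriv ?_
  rw [Real.rpow_sub_one (by positivity), ← hk, ← hc, ← hs']
  have hn : ‖s⁻¹ • y - (c / s) • x‖ ^ 2 =
      (‖y‖ ^ 2 - 2 * c * ⟪x, y⟫_ℝ + c ^ 2 * ‖x‖ ^ 2) / s ^ 2 := by
    rw [@norm_sub_sq_real, norm_smul, norm_smul, mul_pow, mul_pow, Real.norm_eq_abs,
      Real.norm_eq_abs, sq_abs, sq_abs, inner_smul_left, inner_smul_right, real_inner_comm]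
    simp
    field_simp
  rw [hn]
  simp only [mehlerKernel, harmonicPotential, ← hk, ← hc, ← hs', Pi.neg_apply, Pi.div_apply]
  field_simp
  linear_combination (k * ‖y‖ ^ 2) * hcs

theorem mehlerKernel_initial {d : ℕ} (f : E d → ℝ) (hf : Continuous f) (hb : ∃ C, ∀ y, |f y| ≤ C)
    (x : E d) :
    Tendsto (fun t => ∫ y, mehlerKernel x t y * f y) (𝓝[>] 0) (𝓝 (f x)) := by
  obtain ⟨C, hC⟩ := hb
  let G : E d → ℝ := fun z => (2 * Real.pi) ^ (-(d : ℝ) / 2) * Real.exp (-(1 / 2) * ‖z‖ ^ 2)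
  have hG1 : ∫ z, G z = 1 := by
    simp only [G]
    rw [integral_const_mul, GaussianFourier.integral_rexp_neg_mul_sq_norm (by norm_num)]
    rw [finrank_euclideanSpace_fin, neg_div, Real.rpow_neg (by positivity)]
    rw [show Real.pi / (1 / 2) = 2 * Real.pi by ring]
    exact inv_mul_cancel₀ (by positivity)
  have hGi : Integrable G := by
    by_contra h
    rw [integral_undef h] at hG1
    exact zero_ne_one hG1
  have key : ∀ t : ℝ, 0 < t → ∫ y, mehlerKernel x t y * f y =
      (Real.cosh t ^ (-(d : ℝ) / 2) * Real.exp (-(‖x‖ ^ 2 * Real.sinh t / (2 * Real.cosh t)))) *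
        ∫ z, G z * f ((Real.cosh t)⁻¹ • x + √(Real.sinh t / Real.cosh t) • z) := by
    intro t ht
    have hs : 0 < Real.sinh t := Real.sinh_pos_iff.2 ht
    have hc : 0 < Real.cosh t := Real.cosh_pos t
    have hr : 0 < √(Real.sinh t / Real.cosh t) := Real.sqrt_pos.2 (by positivity)
    have hr2 : √(Real.sinh t / Real.cosh t) ^ 2 = Real.sinh t / Real.cosh t :=
      Real.sq_sqrt (by positivity)
    have e1 := integral_add_left_eq_self (μ := (volume : Measure (E d)))
      (fun y => mehlerKernel x t y * f y) ((Real.cosh t)⁻¹ • x)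
    have e2 := Measure.integral_comp_smul (volume : Measure (E d))
      (fun z => mehlerKernel x t ((Real.cosh t)⁻¹ • x + z) * f ((Real.cosh t)⁻¹ • x + z))
      (√(Real.sinh t / Real.cosh t))
    rw [e1, finrank_euclideanSpace_fin, abs_of_pos (by positivity), smul_eq_mul] at e2
    have e3 : ∫ y, mehlerKernel x t y * f y = √(Real.sinh t / Real.cosh t) ^ d *
      ∫ z, mehlerKernel x t ((Real.cosh t)⁻¹ • x + √(Real.sinh t / Real.cosh t) • z) *
        f ((Real.cosh t)⁻¹ • x + √(Real.sinh t / Real.cosh t) • z) := by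
      rw [e2, mul_inv_cancel_left₀ (by positivity)]
    rw [e3, ← integral_const_mul, ← integral_const_mul]
    congr 1
    ext z
    rw [← mul_assoc, ← mul_assoc]
    congr 1
    have hcs : Real.cosh t ^ 2 = Real.sinh t ^ 2 + 1 := Real.cosh_sq t
    have hp : √(Real.sinh t / Real.cosh t) ^ d * (2 * Real.pi * Real.sinh t) ^ (-(d : ℝ) / 2) =
        Real.cosh t ^ (-(d : ℝ) / 2) * (2 * Real.pi) ^ (-(d : ℝ) / 2) := by
      rw [Real.mul_rpow (by positivity) hs.le, Real.sqrt_eq_rpow, ← Real.rpow_natCast,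
        ← Real.rpow_mul (by positivity), Real.div_rpow hs.le hc.le, neg_div, Real.rpow_neg hs.le,
        Real.rpow_neg hc.le, show 1 / 2 * (d : ℝ) = d / 2 by ring]
      field_simp
    simp only [mehlerKernel, G]
    rw [← mul_assoc, hp, mul_mul_mul_comm, mul_assoc, mul_assoc, ← Real.exp_add]
    congr 3
    rw [@norm_add_sq_real, norm_smul, norm_smul, inner_add_right, inner_smul_right,
      inner_smul_right, inner_smul_left, inner_smul_right, mul_pow, mul_pow, Real.norm_eq_abs,
      Real.norm_eq_abs, sq_abs, sq_abs, hr2, real_inner_self_eq_norm_sq]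
    simp only [conj_trivial]
    field_simp
    linear_combination (-‖x‖ ^ 2) * hcs
  have lim1 : Tendsto (fun t : ℝ => Real.cosh t ^ (-(d : ℝ) / 2) *
      Real.exp (-(‖x‖ ^ 2 * Real.sinh t / (2 * Real.cosh t)))) (𝓝[>] 0) (𝓝 1) := by
    have : ContinuousAt (fun t : ℝ => Real.cosh t ^ (-(d : ℝ) / 2) *
      Real.exp (-(‖x‖ ^ 2 * Real.sinh t / (2 * Real.cosh t)))) 0 := by
      refine (Real.continuous_cosh.continuousAt.rpow_const (Or.inl (Real.cosh_pos 0).ne')).mul ?_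
      refine (ContinuousAt.div ?_ ?_ (by simp)).neg.rexp
      · exact (continuous_const.mul Real.continuous_sinh).continuousAt
      · exact (continuous_const.mul Real.continuous_cosh).continuousAt
    simpa [ContinuousAt] using this.mono_left (nhdsWithin_le_nhds (s := Ioi 0))
  have lim2 : Tendsto (fun t : ℝ => ∫ z, G z * f ((Real.cosh t)⁻¹ • x +
      √(Real.sinh t / Real.cosh t) • z)) (𝓝[>] 0) (𝓝 (∫ z, G z * f x)) := by
    refine tendsto_integral_filter_of_dominated_convergence (fun z => G z * C) ?_ ?_
      (hGi.mul_const C) ?_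
    · refine Eventually.of_forall fun t => hGi.aestronglyMeasurable.mul ?_
      exact (hf.comp (by fun_prop)).aestronglyMeasurable
    · refine Eventually.of_forall fun t => Eventually.of_forall fun z => ?_
      have : 0 ≤ G z := by positivity
      rw [Real.norm_eq_abs, abs_mul, abs_of_nonneg this]
      exact mul_le_mul_of_nonneg_left (hC _) this
    · refine Eventually.of_forall fun z => ?_
      have : ContinuousAt (fun t : ℝ => G z * f ((Real.cosh t)⁻¹ • x +
          √(Real.sinh t / Real.cosh t) • z)) 0 := by
        refine continuousAt_const.mul (hf.continuousAt.comp ?_)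
        refine ((Real.continuous_cosh.continuousAt.inv₀ (by simp)).smul continuousAt_const).add ?_
        refine ((Real.continuous_sinh.continuousAt.div Real.continuous_cosh.continuousAt
          (by simp)).sqrt).smul continuousAt_const
      simpa [ContinuousAt] using this.mono_left (nhdsWithin_le_nhds (s := Ioi 0))
  have := lim1.mul lim2
  rw [integral_mul_const, hG1, one_mul, one_mul] at this
  refine this.congr' ?_
  filter_upwards [self_mem_nhdsWithin] with t ht
  exact (key t ht).symm

theorem isGreenFunction_mehlerKernel (d : ℕ) :
    IsGreenFunction (harmonicPotential (d := d)) mehlerKernel where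
  pos x y t ht := by
    have hs : 0 < Real.sinh t := Real.sinh_pos_iff.2 ht
    unfold mehlerKernel
    positivity
  symm x y t _ := by
    unfold mehlerKernel
    rw [real_inner_comm, add_comm (‖x‖ ^ 2)]
  equation := mehlerKernel_equation
  initial := mehlerKernel_initial

end Bernstein

/-!
The law of `(Z_0, Z_T)` has a density proportional to
`φ₀(x) ψ_T(y) exp(-q_T(x, y))`, where `q_T` is the quadratic exponent of Mehler's kernel; the
prefactor `(2π sinh T)^(-d/2)` cancels against the normalization. As `T → ∞`, `q_T` tends to
`(|x|² + |y|²) / 2`, and the limit density `φ₀(x) exp(-|x|²/2) ψ_T(y) exp(-|y|²/2)` is, after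
completing squares, the product of the two Gaussians of variances `ρ₀`, `ρ_T` and centres
`a₀ / (1 + σ₀)`, `a_T / (1 + σ_T)`.

The rate is elementary. Both exponents are nonnegative, so `exp(-·)` is `1`-Lipschitz on them, and
they differ by at most `4 e^(-T) (|x|² + |y|²)` for `T ≥ 1`
(`abs_mehlerExponent_sub_le`). The second moments of `φ₀ ⊗ ψ_T` are finite, which bounds the `L¹`
distance of the unnormalized densities by a multiple of `e^(-T)`
(`integral_abs_sub_le`). Normalizing costs only a factor `2` divided by the mass of the limit
(`abs_setIntegral_div_sub_le`), so the estimate holds uniformly over all measurable sets of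
pairs; the marginals are the cases `F₀ × ℝ^d` and `ℝ^d × F_T`. A stationary process has the law of
`Z_0` at every time, which gives the last statement.
-/

namespace Bernstein

variable {d : ℕ}

/-! ### Normalizing two nearby densities -/

theorem abs_exp_neg_sub_exp_neg_le {p q : ℝ} (hp : 0 ≤ p) (hq : 0 ≤ q) :
    |Real.exp (-p) - Real.exp (-q)| ≤ |p - q| := by
  have key : ∀ a b : ℝ, 0 ≤ a → a ≤ b → Real.exp (-a) - Real.exp (-b) ≤ b - a := by
    intro a b ha hab
    have h1 : Real.exp (-a) ≤ 1 := Real.exp_le_one_iff.2 (by linarith)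
    have h2 : Real.exp (-b) = Real.exp (-a) * Real.exp (-(b - a)) := by
      rw [← Real.exp_add]
      ring_nf
    have h3 := Real.add_one_le_exp (-(b - a))
    nlinarith [Real.exp_pos (-a)]
  rcases le_total p q with h | h
  · rw [abs_of_nonneg (sub_nonneg.2 (Real.exp_le_exp.2 (by linarith))), abs_sub_comm,
      abs_of_nonneg (sub_nonneg.2 h)]
    exact key p q hp h
  · rw [abs_sub_comm, abs_of_nonneg (sub_nonneg.2 (Real.exp_le_exp.2 (by linarith))),
      abs_of_nonneg (sub_nonneg.2 h)]
    exact key q p hq h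

/-- The probability measures with densities proportional to `f` and `g` differ on every
set by at most `2 ‖f - g‖₁ / ∫ g`. -/
theorem abs_setIntegral_div_sub_le {α : Type*} [MeasurableSpace α] {m : Measure α} {f g : α → ℝ}
    (hf : Integrable f m) (hg : Integrable g m) (hf0 : ∀ x, 0 ≤ f x) (hfpos : 0 < ∫ x, f x ∂m)
    (hgpos : 0 < ∫ x, g x ∂m) {δ : ℝ} (hδ : ∫ x, |f x - g x| ∂m ≤ δ) (A : Set α) :
    |(∫ x in A, f x ∂m) / (∫ x, f x ∂m) - (∫ x in A, g x ∂m) / (∫ x, g x ∂m)| ≤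
      2 * δ / ∫ x, g x ∂m := by
  have hi : Integrable (fun x => |f x - g x|) m := (hf.sub hg).abs
  have hA : |(∫ x in A, f x ∂m) - ∫ x in A, g x ∂m| ≤ δ := by
    rw [← integral_sub hf.integrableOn hg.integrableOn]
    refine (abs_integral_le_integral_abs).trans (le_trans ?_ hδ)
    exact setIntegral_le_integral hi (Eventually.of_forall fun x => abs_nonneg _)
  have hU : |(∫ x, f x ∂m) - ∫ x, g x ∂m| ≤ δ := by
    rw [← integral_sub hf hg]
    exact (abs_integral_le_integral_abs).trans hδ
  have h0 : 0 ≤ ∫ x in A, f x ∂m := integral_nonneg hf0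
  have h1 : ∫ x in A, f x ∂m ≤ ∫ x, f x ∂m :=
    setIntegral_le_integral hf (Eventually.of_forall hf0)
  generalize (∫ x in A, f x ∂m) = a at *
  generalize (∫ x in A, g x ∂m) = b at *
  generalize (∫ x, f x ∂m) = I at *
  generalize (∫ x, g x ∂m) = J at *
  have e : a / I - b / J = ((a - b) + a / I * (J - I)) / J := by
    field_simp
    ring
  rw [e, abs_div, abs_of_pos hgpos]
  gcongr
  have h2 : |a / I| ≤ 1 := by
    rw [abs_of_nonneg (by positivity)]
    exact (div_le_one hfpos).2 h1
  calc |a - b + a / I * (J - I)| ≤ |a - b| + |a / I| * |J - I| := by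
        rw [← abs_mul]
        exact abs_add_le _ _
    _ ≤ δ + 1 * δ := by
        rw [abs_sub_comm J I]
        gcongr
    _ = 2 * δ := by ring

/-! ### Gaussian integrals -/

theorem integral_exp_neg_mul_norm_sub_sq {b : ℝ} (hb : 0 < b) (a : E d) :
    ∫ x : E d, Real.exp (-b * ‖x - a‖ ^ 2) = (Real.pi / b) ^ ((d : ℝ) / 2) := by
  rw [integral_sub_right_eq_self (fun x : E d => Real.exp (-b * ‖x‖ ^ 2)) a,
    GaussianFourier.integral_rexp_neg_mul_sq_norm hb, finrank_euclideanSpace_fin]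

theorem integrable_exp_neg_mul_norm_sub_sq {b : ℝ} (hb : 0 < b) (a : E d) :
    Integrable fun x : E d => Real.exp (-b * ‖x - a‖ ^ 2) := by
  refine Integrable.of_integral_ne_zero ?_
  rw [integral_exp_neg_mul_norm_sub_sq hb]
  positivity

theorem gaussianFun_pos (σ : ℝ) (a x : E d) : 0 < gaussianFun σ a x := Real.exp_pos _

theorem continuous_gaussianFun (σ : ℝ) (a : E d) : Continuous (gaussianFun σ a) := by
  unfold gaussianFun
  fun_prop

theorem integrable_gaussianFun {σ : ℝ} (hσ : 0 < σ) (a : E d) : Integrable (gaussianFun σ a) := by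
  refine (integrable_exp_neg_mul_norm_sub_sq (b := (2 * σ)⁻¹) (by positivity) a).congr
    (Eventually.of_forall fun x => ?_)
  simp only [gaussianFun]
  congr 1
  ring

theorem integrable_gaussianFun_mul_norm_sq {σ : ℝ} (hσ : 0 < σ) (a : E d) :
    Integrable fun x => gaussianFun σ a x * ‖x‖ ^ 2 := by
  -- One half of the exponent absorbs the polynomial factor, by `u ≤ exp u`.
  refine (((integrable_gaussianFun (σ := 2 * σ) (by positivity) a).const_mul (8 * σ)).add
    ((integrable_gaussianFun hσ a).const_mul (2 * ‖a‖ ^ 2))).mono'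
    ((continuous_gaussianFun σ a).mul (by fun_prop)).aestronglyMeasurable
    (Eventually.of_forall fun x => ?_)
  have h1 : ‖x‖ ^ 2 ≤ 2 * ‖x - a‖ ^ 2 + 2 * ‖a‖ ^ 2 := by
    have h := norm_add_le (x - a) a
    rw [sub_add_cancel] at h
    nlinarith [norm_nonneg x, norm_nonneg (x - a), norm_nonneg a, sq_nonneg (‖x - a‖ - ‖a‖)]
  have h2 : gaussianFun σ a x * ‖x - a‖ ^ 2 ≤ 4 * σ * gaussianFun (2 * σ) a x := by
    have h3 : ‖x - a‖ ^ 2 / (4 * σ) ≤ Real.exp (‖x - a‖ ^ 2 / (4 * σ)) := by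
      linarith [Real.add_one_le_exp (‖x - a‖ ^ 2 / (4 * σ))]
    have h4 : gaussianFun (2 * σ) a x =
        gaussianFun σ a x * Real.exp (‖x - a‖ ^ 2 / (4 * σ)) := by
      simp only [gaussianFun]
      rw [← Real.exp_add]
      congr 1
      field_simp
      ring
    rw [div_le_iff₀ (by positivity)] at h3
    rw [h4]
    nlinarith [mul_le_mul_of_nonneg_left h3 (gaussianFun_pos σ a x).le]
  have hg := gaussianFun_pos σ a x
  rw [Real.norm_of_nonneg (by positivity)]
  simp only [Pi.add_apply]
  nlinarith [mul_le_mul_of_nonneg_left h1 hg.le]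

theorem rho_pos {σ : ℝ} (hσ : 0 < σ) : 0 < rho σ := by
  unfold rho
  positivity

/-- Completing the square: multiplied by the ground state `exp(-|x|²/2)`, the Gaussian of variance
`σ` around `a` becomes a multiple of the one of variance `ρ` around `a / (1 + σ)`. -/
theorem gaussianFun_mul_exp {σ : ℝ} (hσ : 0 < σ) (a x : E d) :
    gaussianFun σ a x * Real.exp (-(‖x‖ ^ 2 / 2)) =
      Real.exp (-(‖a‖ ^ 2 / (2 * (1 + σ)))) *
        Real.exp (-(1 / (2 * rho σ)) * ‖x - (1 + σ)⁻¹ • a‖ ^ 2) := by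
  have h1 : 1 + σ ≠ 0 := by positivity
  simp only [gaussianFun, rho]
  rw [← Real.exp_add, ← Real.exp_add, @norm_sub_sq_real, @norm_sub_sq_real, norm_smul, mul_pow,
    Real.norm_eq_abs, sq_abs, inner_smul_right]
  congr 1
  field_simp
  ring

theorem gaussianIntegral_univ {σ : ℝ} (hσ : 0 < σ) (a : E d) :
    gaussianIntegral σ a univ = (2 * Real.pi * rho σ) ^ ((d : ℝ) / 2) := by
  have := rho_pos hσ
  rw [gaussianIntegral, setIntegral_univ, integral_exp_neg_mul_norm_sub_sq (by positivity)]
  congr 1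
  field_simp

theorem normalized_gaussianIntegral_univ {σ : ℝ} (hσ : 0 < σ) (a : E d) :
    (2 * Real.pi * rho σ) ^ (-(d : ℝ) / 2) * gaussianIntegral σ a univ = 1 := by
  have := rho_pos hσ
  rw [gaussianIntegral_univ hσ, neg_div, Real.rpow_neg (by positivity)]
  exact inv_mul_cancel₀ (by positivity)

/-! ### The unnormalized endpoint densities -/

/-- The exponent of Mehler's kernel, `mehlerKernel x T y = (2π sinh T)^(-d/2) exp(-q_T(x, y))`. -/
noncomputable def mehlerExponent (T : ℝ) (x y : E d) : ℝ :=
  (Real.cosh T * (‖x‖ ^ 2 + ‖y‖ ^ 2) - 2 * ⟪x, y⟫_ℝ) / (2 * Real.sinh T)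

theorem mehlerExponent_nonneg {T : ℝ} (hT : 0 < T) (x y : E d) : 0 ≤ mehlerExponent T x y := by
  have hs : 0 < Real.sinh T := Real.sinh_pos_iff.2 hT
  refine div_nonneg ?_ (by positivity)
  have h1 := Real.one_le_cosh T
  have h2 := real_inner_le_norm x y
  nlinarith [sq_nonneg (‖x‖ - ‖y‖), sq_nonneg ‖x‖, sq_nonneg ‖y‖]

/-- The exponent of Mehler's kernel converges to the one of the product of the ground states at the
rate `e^(-T)`. The restriction `1 ≤ T` only serves to have `sinh T ≥ e^T / 4`. -/
theorem abs_mehlerExponent_sub_le {T : ℝ} (hT : 1 ≤ T) (x y : E d) :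
    |mehlerExponent T x y - (‖x‖ ^ 2 / 2 + ‖y‖ ^ 2 / 2)| ≤
      4 * Real.exp (-T) * (‖x‖ ^ 2 + ‖y‖ ^ 2) := by
  have hs : 0 < Real.sinh T := Real.sinh_pos_iff.2 (by linarith)
  have he : Real.exp (-T) ≤ 1 / 2 := by
    have h1 : Real.exp T * Real.exp (-T) = 1 := by rw [← Real.exp_add]; simp
    nlinarith [Real.add_one_le_exp T, Real.exp_pos (-T)]
  have hsinh : 1 ≤ 4 * Real.exp (-T) * Real.sinh T := by
    have h1 : Real.exp T * Real.exp (-T) = 1 := by rw [← Real.exp_add]; simp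
    rw [Real.sinh_eq]
    nlinarith [Real.exp_pos (-T)]
  have e : mehlerExponent T x y - (‖x‖ ^ 2 / 2 + ‖y‖ ^ 2 / 2) =
      (Real.exp (-T) * (‖x‖ ^ 2 + ‖y‖ ^ 2) / 2 - ⟪x, y⟫_ℝ) / Real.sinh T := by
    rw [mehlerExponent, ← Real.cosh_sub_sinh]
    field_simp
    ring
  have hxy : |⟪x, y⟫_ℝ| ≤ (‖x‖ ^ 2 + ‖y‖ ^ 2) / 2 := by
    nlinarith [abs_real_inner_le_norm x y, sq_nonneg (‖x‖ - ‖y‖)]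
  have hpos := Real.exp_pos (-T)
  have hQ : 0 ≤ ‖x‖ ^ 2 + ‖y‖ ^ 2 := by positivity
  generalize ‖x‖ ^ 2 + ‖y‖ ^ 2 = Q at *
  rw [e, abs_div, abs_of_pos hs, div_le_iff₀ hs]
  have h3 : |Real.exp (-T) * Q / 2 - ⟪x, y⟫_ℝ| ≤ Q := by
    refine (abs_sub _ _).trans ?_
    rw [abs_of_nonneg (by positivity)]
    nlinarith
  nlinarith

/-- The endpoint density without its normalization and without the prefactor of Mehler's kernel. -/
noncomputable def endpointWeight (σ₀ σT : ℝ) (a₀ aT : E d) (T : ℝ) (p : E d × E d) : ℝ :=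
  gaussianFun σ₀ a₀ p.1 * gaussianFun σT aT p.2 * Real.exp (-mehlerExponent T p.1 p.2)

/-- The limit of `endpointWeight` as `T → ∞`. -/
noncomputable def limitWeight (σ₀ σT : ℝ) (a₀ aT : E d) (p : E d × E d) : ℝ :=
  gaussianFun σ₀ a₀ p.1 * gaussianFun σT aT p.2 * Real.exp (-(‖p.1‖ ^ 2 / 2 + ‖p.2‖ ^ 2 / 2))

section Weights

variable {σ₀ σT : ℝ} (a₀ aT : E d)

theorem endpointWeight_pos (T : ℝ) (p : E d × E d) : 0 < endpointWeight σ₀ σT a₀ aT T p :=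
  mul_pos (mul_pos (gaussianFun_pos ..) (gaussianFun_pos ..)) (Real.exp_pos _)

theorem limitWeight_pos (p : E d × E d) : 0 < limitWeight σ₀ σT a₀ aT p :=
  mul_pos (mul_pos (gaussianFun_pos ..) (gaussianFun_pos ..)) (Real.exp_pos _)

theorem continuous_gaussianFun_mul_gaussianFun :
    Continuous fun p : E d × E d => gaussianFun σ₀ a₀ p.1 * gaussianFun σT aT p.2 :=
  ((continuous_gaussianFun σ₀ a₀).comp continuous_fst).mul
    ((continuous_gaussianFun σT aT).comp continuous_snd)

theorem continuous_endpointWeight (T : ℝ) : Continuous (endpointWeight σ₀ σT a₀ aT T) := by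
  refine (continuous_gaussianFun_mul_gaussianFun a₀ aT).mul ?_
  unfold mehlerExponent
  fun_prop

variable (hσ₀ : 0 < σ₀) (hσT : 0 < σT)
include hσ₀ hσT

theorem integrable_gaussianFun_mul_gaussianFun :
    Integrable fun p : E d × E d => gaussianFun σ₀ a₀ p.1 * gaussianFun σT aT p.2 :=
  (integrable_gaussianFun hσ₀ a₀).mul_prod (integrable_gaussianFun hσT aT)

theorem integrable_gaussianFun_mul_gaussianFun_mul_norm_sq :
    Integrable fun p : E d × E d =>
      gaussianFun σ₀ a₀ p.1 * gaussianFun σT aT p.2 * (‖p.1‖ ^ 2 + ‖p.2‖ ^ 2) := by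
  refine (((integrable_gaussianFun_mul_norm_sq hσ₀ a₀).mul_prod
    (integrable_gaussianFun hσT aT)).add ((integrable_gaussianFun hσ₀ a₀).mul_prod
    (integrable_gaussianFun_mul_norm_sq hσT aT))).congr (Eventually.of_forall fun p => ?_)
  simp only [Pi.add_apply]
  ring

theorem integrable_endpointWeight {T : ℝ} (hT : 0 < T) :
    Integrable (endpointWeight σ₀ σT a₀ aT T) := by
  refine (integrable_gaussianFun_mul_gaussianFun a₀ aT hσ₀ hσT).mono'
    (continuous_endpointWeight a₀ aT T).aestronglyMeasurable (Eventually.of_forall fun p => ?_)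
  rw [Real.norm_of_nonneg (endpointWeight_pos ..).le]
  refine mul_le_of_le_one_right (mul_pos (gaussianFun_pos ..) (gaussianFun_pos ..)).le ?_
  exact Real.exp_le_one_iff.2 (neg_nonpos.2 (mehlerExponent_nonneg hT _ _))

theorem integrable_limitWeight : Integrable (limitWeight σ₀ σT a₀ aT) := by
  refine (integrable_gaussianFun_mul_gaussianFun a₀ aT hσ₀ hσT).mono'
    ((continuous_gaussianFun_mul_gaussianFun a₀ aT).mul (by fun_prop)).aestronglyMeasurable
    (Eventually.of_forall fun p => ?_)
  rw [Real.norm_of_nonneg (limitWeight_pos ..).le]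
  refine mul_le_of_le_one_right (mul_pos (gaussianFun_pos ..) (gaussianFun_pos ..)).le ?_
  exact Real.exp_le_one_iff.2 (neg_nonpos.2 (by positivity))

theorem integral_endpointWeight_pos {T : ℝ} (hT : 0 < T) :
    0 < ∫ p, endpointWeight σ₀ σT a₀ aT T p := by
  refine (integral_pos_iff_support_of_nonneg (fun p => (endpointWeight_pos a₀ aT T p).le)
    (integrable_endpointWeight a₀ aT hσ₀ hσT hT)).2 ?_
  rw [Function.support_eq_univ (fun p => (endpointWeight_pos a₀ aT T p).ne')]
  exact Measure.measure_univ_pos.2 (NeZero.ne _)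

theorem integral_limitWeight_pos : 0 < ∫ p, limitWeight σ₀ σT a₀ aT p := by
  refine (integral_pos_iff_support_of_nonneg (fun p => (limitWeight_pos a₀ aT p).le)
    (integrable_limitWeight a₀ aT hσ₀ hσT)).2 ?_
  rw [Function.support_eq_univ (fun p => (limitWeight_pos a₀ aT p).ne')]
  exact Measure.measure_univ_pos.2 (NeZero.ne _)

/-- The `L¹` distance of the unnormalized densities decays like `e^(-T)`. -/
theorem integral_abs_sub_le {T : ℝ} (hT : 1 ≤ T) :
    ∫ p, |endpointWeight σ₀ σT a₀ aT T p - limitWeight σ₀ σT a₀ aT p| ≤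
      4 * Real.exp (-T) * ∫ p : E d × E d,
        gaussianFun σ₀ a₀ p.1 * gaussianFun σT aT p.2 * (‖p.1‖ ^ 2 + ‖p.2‖ ^ 2) := by
  rw [← integral_const_mul]
  refine integral_mono ((integrable_endpointWeight a₀ aT hσ₀ hσT (by linarith)).sub
    (integrable_limitWeight a₀ aT hσ₀ hσT)).abs
    ((integrable_gaussianFun_mul_gaussianFun_mul_norm_sq a₀ aT hσ₀ hσT).const_mul _) fun p => ?_
  have h := (abs_exp_neg_sub_exp_neg_le (mehlerExponent_nonneg (by linarith : 0 < T) p.1 p.2)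
    (by positivity : 0 ≤ ‖p.1‖ ^ 2 / 2 + ‖p.2‖ ^ 2 / 2)).trans
    (abs_mehlerExponent_sub_le hT p.1 p.2)
  have hg : 0 < gaussianFun σ₀ a₀ p.1 * gaussianFun σT aT p.2 :=
    mul_pos (gaussianFun_pos ..) (gaussianFun_pos ..)
  simp only [endpointWeight, limitWeight]
  rw [← mul_sub, abs_mul, abs_of_pos hg]
  exact (mul_le_mul_of_nonneg_left h hg.le).trans_eq (by ring)

theorem setIntegral_limitWeight_prod (F₀ FT : Set (E d)) :
    ∫ p in F₀ ×ˢ FT, limitWeight σ₀ σT a₀ aT p =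
      Real.exp (-(‖a₀‖ ^ 2 / (2 * (1 + σ₀)))) * Real.exp (-(‖aT‖ ^ 2 / (2 * (1 + σT)))) *
        (gaussianIntegral σ₀ a₀ F₀ * gaussianIntegral σT aT FT) := by
  simp only [gaussianIntegral]
  rw [← setIntegral_prod_mul, ← integral_const_mul]
  refine integral_congr_ae (Eventually.of_forall fun p => ?_)
  have h : limitWeight σ₀ σT a₀ aT p =
      gaussianFun σ₀ a₀ p.1 * Real.exp (-(‖p.1‖ ^ 2 / 2)) *
        (gaussianFun σT aT p.2 * Real.exp (-(‖p.2‖ ^ 2 / 2))) := by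
    rw [limitWeight, neg_add, Real.exp_add]
    ring
  simp only [h, gaussianFun_mul_exp hσ₀, gaussianFun_mul_exp hσT]
  ring

/-- The normalized limit measure is the product of the two normalized Gaussians. -/
theorem setIntegral_limitWeight_div (F₀ FT : Set (E d)) :
    (∫ p in F₀ ×ˢ FT, limitWeight σ₀ σT a₀ aT p) / ∫ p, limitWeight σ₀ σT a₀ aT p =
      ((2 * Real.pi * rho σ₀) ^ (-(d : ℝ) / 2) * gaussianIntegral σ₀ a₀ F₀) *
        ((2 * Real.pi * rho σT) ^ (-(d : ℝ) / 2) * gaussianIntegral σT aT FT) := by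
  have h₀ := rho_pos hσ₀
  have hT := rho_pos hσT
  rw [← setIntegral_univ (μ := volume) (f := limitWeight σ₀ σT a₀ aT), ← univ_prod_univ,
    setIntegral_limitWeight_prod a₀ aT hσ₀ hσT, setIntegral_limitWeight_prod a₀ aT hσ₀ hσT,
    gaussianIntegral_univ hσ₀, gaussianIntegral_univ hσT, neg_div, Real.rpow_neg (by positivity),
    Real.rpow_neg (by positivity)]
  field_simp

/-! ### The law of the endpoints -/

/-- The normalization cancels the prefactor of Mehler's kernel. -/
theorem endpointMeasure_real {T : ℝ} (hT : 0 < T) {A : Set (E d × E d)} (hA : MeasurableSet A) :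
    (endpointMeasure mehlerKernel (gaussianFun σ₀ a₀) (gaussianFun σT aT) T).real A =
      (∫ p in A, endpointWeight σ₀ σT a₀ aT T p) / ∫ p, endpointWeight σ₀ σT a₀ aT T p := by
  have hs : 0 < Real.sinh T := Real.sinh_pos_iff.2 hT
  have hI := integral_endpointWeight_pos a₀ aT hσ₀ hσT hT
  have hw : ∀ p : E d × E d,
      gaussianFun σ₀ a₀ p.1 * mehlerKernel p.1 T p.2 * gaussianFun σT aT p.2 =
        (2 * Real.pi * Real.sinh T) ^ (-(d : ℝ) / 2) * endpointWeight σ₀ σT a₀ aT T p := by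
    intro p
    simp only [mehlerKernel, endpointWeight, mehlerExponent, neg_div]
    ring
  have hc : 0 < (2 * Real.pi * Real.sinh T) ^ (-(d : ℝ) / 2) := by positivity
  have hN : normFactor mehlerKernel (gaussianFun σ₀ a₀) (gaussianFun σT aT) T ^ 2 *
      (2 * Real.pi * Real.sinh T) ^ (-(d : ℝ) / 2) =
      (∫ p, endpointWeight σ₀ σT a₀ aT T p)⁻¹ := by
    simp only [normFactor, hw, integral_const_mul]
    rw [inv_pow, Real.sq_sqrt (mul_pos hc hI).le]
    field_simp
  have hdens : ∀ p : E d × E d,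
      normFactor mehlerKernel (gaussianFun σ₀ a₀) (gaussianFun σT aT) T * gaussianFun σ₀ a₀ p.1 *
        mehlerKernel p.1 T p.2 *
        (normFactor mehlerKernel (gaussianFun σ₀ a₀) (gaussianFun σT aT) T *
          gaussianFun σT aT p.2) =
      (∫ p, endpointWeight σ₀ σT a₀ aT T p)⁻¹ * endpointWeight σ₀ σT a₀ aT T p := by
    intro p
    rw [← hN, mul_assoc _ _ (endpointWeight ..), ← hw]
    ring
  simp only [endpointMeasure, hdens]
  rw [measureReal_def, withDensity_apply _ hA, ← integral_eq_lintegral_of_nonneg_ae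
    (Eventually.of_forall fun p => (mul_pos (inv_pos.2 hI) (endpointWeight_pos a₀ aT T p)).le)
    ((continuous_endpointWeight a₀ aT T).const_mul _).aestronglyMeasurable, integral_const_mul,
    inv_mul_eq_div]

/-- On products of measurable sets, the law of the endpoints is close to the product Gaussian. -/
theorem exists_abs_endpointMeasure_real_sub_le :
    ∃ C : ℝ, ∀ T : ℝ, 1 ≤ T → ∀ F₀ FT : Set (E d), MeasurableSet F₀ → MeasurableSet FT →
      |(endpointMeasure mehlerKernel (gaussianFun σ₀ a₀) (gaussianFun σT aT) T).real (F₀ ×ˢ FT) -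
        ((2 * Real.pi * rho σ₀) ^ (-(d : ℝ) / 2) * gaussianIntegral σ₀ a₀ F₀) *
          ((2 * Real.pi * rho σT) ^ (-(d : ℝ) / 2) * gaussianIntegral σT aT FT)| ≤
        C * Real.exp (-T) := by
  refine ⟨8 * (∫ p : E d × E d,
    gaussianFun σ₀ a₀ p.1 * gaussianFun σT aT p.2 * (‖p.1‖ ^ 2 + ‖p.2‖ ^ 2)) /
    (∫ p, limitWeight σ₀ σT a₀ aT p), fun T hT F₀ FT hF₀ hFT => ?_⟩
  have hT0 : 0 < T := by linarith
  rw [endpointMeasure_real a₀ aT hσ₀ hσT hT0 (hF₀.prod hFT),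
    ← setIntegral_limitWeight_div a₀ aT hσ₀ hσT]
  refine (abs_setIntegral_div_sub_le (integrable_endpointWeight a₀ aT hσ₀ hσT hT0)
    (integrable_limitWeight a₀ aT hσ₀ hσT) (fun p => (endpointWeight_pos a₀ aT T p).le)
    (integral_endpointWeight_pos a₀ aT hσ₀ hσT hT0) (integral_limitWeight_pos a₀ aT hσ₀ hσT)
    (integral_abs_sub_le a₀ aT hσ₀ hσT hT) _).trans_eq ?_
  ring

end Weights

/-- One-dimensional distributions of a stationary process are constant in time. -/
theorem IsStationaryOn.measureReal_preimage_eq {Ω : Type*} [MeasurableSpace Ω] {T : ℝ}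
    {Pr : Measure Ω} {Z : ℝ → Ω → E d} (hZ : IsStationaryOn T Pr Z)
    (hm : ∀ τ ∈ Icc 0 T, Measurable (Z τ)) {t : ℝ} (ht : t ∈ Icc 0 T) {F : Set (E d)}
    (hF : MeasurableSet F) : Pr.real (Z t ⁻¹' F) = Pr.real (Z 0 ⁻¹' F) := by
  have h0 : (0 : ℝ) ∈ Icc 0 T := ⟨le_rfl, ht.1.trans ht.2⟩
  have h := hZ 1 (fun _ => 0) t (fun _ => h0) (fun _ => by simpa using ht)
  have hS : MeasurableSet {w : Fin 1 → E d | w 0 ∈ F} := measurable_pi_apply 0 hF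
  have h2 := congrArg (fun m : Measure (Fin 1 → E d) => m {w : Fin 1 → E d | w 0 ∈ F}) h
  simp only [zero_add] at h2
  rw [Measure.map_apply (measurable_pi_lambda _ fun _ => hm t ht) hS,
    Measure.map_apply (measurable_pi_lambda _ fun _ => hm 0 h0) hS] at h2
  exact congrArg ENNReal.toReal h2

end Bernstein

theorem proposition4 (d : ℕ) (hd : 1 ≤ d) (σ₀ σT : ℝ) (hσ₀ : 0 < σ₀) (hσT : 0 < σT)
    (a₀ aT : EuclideanSpace ℝ (Fin d)) :
    ∃ C T₁ : ℝ, ∀ T : ℝ, 0 < T → T₁ ≤ T →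
      ∀ (Ω : Type*) [MeasurableSpace Ω] (Pr : Measure Ω) [IsProbabilityMeasure Pr]
        (Z : ℝ → Ω → EuclideanSpace ℝ (Fin d)),
        Bernstein.IsAssociatedBernsteinProcess Bernstein.mehlerKernel
          (Bernstein.gaussianFun σ₀ a₀) (Bernstein.gaussianFun σT aT) T Pr Z →
        -- (a), joint law of the endpoints
        (∀ F₀ FT : Set (EuclideanSpace ℝ (Fin d)), MeasurableSet F₀ → MeasurableSet FT →
          |Pr.real (Z 0 ⁻¹' F₀ ∩ Z T ⁻¹' FT) -
            (4 * Real.pi ^ 2 * Bernstein.rho σ₀ * Bernstein.rho σT) ^ (-(d : ℝ) / 2) *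
              Bernstein.gaussianIntegral σ₀ a₀ F₀ * Bernstein.gaussianIntegral σT aT FT|
            ≤ C * Real.exp (-T)) ∧
        -- (a), law of the initial point
        (∀ F₀ : Set (EuclideanSpace ℝ (Fin d)), MeasurableSet F₀ →
          |Pr.real (Z 0 ⁻¹' F₀) -
            (2 * Real.pi * Bernstein.rho σ₀) ^ (-(d : ℝ) / 2) *
              Bernstein.gaussianIntegral σ₀ a₀ F₀| ≤ C * Real.exp (-T)) ∧
        -- (a), law of the final point
        (∀ FT : Set (EuclideanSpace ℝ (Fin d)), MeasurableSet FT →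
          |Pr.real (Z T ⁻¹' FT) -
            (2 * Real.pi * Bernstein.rho σT) ^ (-(d : ℝ) / 2) *
              Bernstein.gaussianIntegral σT aT FT| ≤ C * Real.exp (-T)) ∧
        -- (b), symmetric data and a stationary process
        (σ₀ = σT → a₀ = aT → Bernstein.IsStationaryOn T Pr Z →
          ∀ t ∈ Icc 0 T, ∀ F : Set (EuclideanSpace ℝ (Fin d)), MeasurableSet F →
            |Pr.real (Z t ⁻¹' F) -
              (2 * Real.pi * Bernstein.rho σ₀) ^ (-(d : ℝ) / 2) *
                Bernstein.gaussianIntegral σ₀ a₀ F| ≤ C * Real.exp (-T)) := by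

  have h₀ := Bernstein.rho_pos hσ₀
  have hT := Bernstein.rho_pos hσT
  obtain ⟨C, key⟩ := Bernstein.exists_abs_endpointMeasure_real_sub_le a₀ aT hσ₀ hσT
  refine ⟨C, 1, fun T hT0 hT1 Ω _ Pr _ Z hZ => ?_⟩
  have joint : ∀ {F₀ FT : Set (EuclideanSpace ℝ (Fin d))}, MeasurableSet F₀ → MeasurableSet FT →
      Pr.real (Z 0 ⁻¹' F₀ ∩ Z T ⁻¹' FT) = (Bernstein.endpointMeasure Bernstein.mehlerKernel
        (Bernstein.gaussianFun σ₀ a₀) (Bernstein.gaussianFun σT aT) T).real (F₀ ×ˢ FT) :=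
    fun hF₀ hFT => congrArg ENNReal.toReal (hZ.joint _ _ hF₀ hFT)
  have initial : ∀ F₀ : Set (EuclideanSpace ℝ (Fin d)), MeasurableSet F₀ →
      |Pr.real (Z 0 ⁻¹' F₀) - (2 * Real.pi * Bernstein.rho σ₀) ^ (-(d : ℝ) / 2) *
        Bernstein.gaussianIntegral σ₀ a₀ F₀| ≤ C * Real.exp (-T) := fun F₀ hF₀ => by
    have h := key T hT1 _ _ hF₀ MeasurableSet.univ
    rwa [← joint hF₀ MeasurableSet.univ, preimage_univ, inter_univ,
      Bernstein.normalized_gaussianIntegral_univ hσT, mul_one] at h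
  refine ⟨fun F₀ FT hF₀ hFT => ?_, initial, fun FT hFT => ?_, fun _ _ hst t ht F hF => ?_⟩
  · have h := key T hT1 _ _ hF₀ hFT
    rw [← joint hF₀ hFT] at h
    convert h using 3
    rw [show 4 * Real.pi ^ 2 * Bernstein.rho σ₀ * Bernstein.rho σT =
      2 * Real.pi * Bernstein.rho σ₀ * (2 * Real.pi * Bernstein.rho σT) by ring,
      Real.mul_rpow (by positivity) (by positivity)]
    ring
  · have h := key T hT1 _ _ MeasurableSet.univ hFT
    rwa [← joint MeasurableSet.univ hFT, preimage_univ, univ_inter,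
      Bernstein.normalized_gaussianIntegral_univ hσ₀, one_mul] at h
  · rw [hst.measureReal_preimage_eq hZ.measurable ht hF]
    exact initial F hF
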